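/- Let $\mathcal Z$ be a measurable space and $\ell:\mathbb R^d\times\mathcal Z\to\mathbb R$ a loss whose gradient $(\theta,z)\mapsto\nabla_\theta\ell(\theta,z)$ is jointly measurable (the gradient is read as $0$ where $\ell(\cdot,z)$ is not differentiable). Let $C>0$ (clipping norm), $\sigma>0$ (noise multiplier), $q\in[0,1]$ (sampling rate), $T\ge 1$ (number of steps), step sizes $\alpha_0,\alpha_1,\ldots\in\mathbb R$ and an initialization $\theta_0\in\mathbb R^d$ be given, and put $\mathrm{clip}_C(v)=v/\max\{1,\|v\|_2/C\}$. For a dataset $D$ (a finite multiset of points of $\mathcal Z$) let $M(D)$ be the law of the sequence $(g_0,\ldots,g_{T-1})$ of all intermediate privatized gradients of DP-SGD: for $t=0,\ldots,T-1$, independently of the past, a mini-batch $B_t$ is formed by including each point of $D$ independently with probability $q$, then $$g_t=\sum_{z\in B_t}\mathrm{clip}_C\big(\nabla_\theta\ell(\theta_t,z)\big)+\xi_t,\qquad \xi_t\sim\mathcal N(0,C^2\sigma^2 I_d),\qquad \theta_{t+1}=\theta_t-\alpha_t g_t ,$$ where $\xi_t$ is drawn independently of $B_t$ and of the past. Let $\pi$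 be any probability measure on $\mathcal Z$ (the prior), $\rho:\mathcal Z\times\mathcal Z\to\mathbb R$ any measurable error function and $\eta\in\mathbb R$. Put $$\kappa_{\pi,\rho}(\eta)=\sup_{z_0\in\mathcal Z}\Pr_{Z\sim\pi}[\rho(Z,z_0)\le\eta],\qquad \mathcal B_\kappa(\mu,\nu)=\sup\{\mu(E): E \text{ an event with } \nu(E)\le\kappa\},$$ $$\nu_{T,\sigma}=\mathcal N(0,\sigma^2I_T),\qquad \mu_{T,\sigma,q}=\sum_{w\in\{0,1\}^T}\Pr[B(q,T)=w]\;\mathcal N(w,\sigma^2I_T),$$ where $B(q,T)$ has $T$ independent Bernoulli($q$) coordinates. Then $M$ is $(\eta,\gamma)$-reconstruction robust with respect to $\pi$ and $\rho$ with $\gamma=\mathcal B_{\kappa_{\pi,\rho}(\eta)}(\mu_{T,\sigma,q},\nu_{T,\sigma})$; that is, for every fixed dataset $D$ and every measurable attack $R:(\mathbb R^d)^T\to\mathcal Z$, $$\Pr_{Z\sim\pi,\;w\sim M(D\cup\{Z\})}\big[\rho(Z,R(w))\le\eta\big]\le\mathcal B_{\kappa_{\pi,\rho}(\eta)}(\mu_{T,\sigma,q},\nu_{T,\sigma}).$$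 -/

import Mathlib

open MeasureTheory ProbabilityTheory
open scoped ENNReal

noncomputable section

/-! ### Prior success probability, blow-up function, reconstruction robustness -/

/-- The prior success probability
`κ_{π,ρ}(η) = sup_{z₀} Pr_{Z ∼ π}[ρ(Z, z₀) ≤ η]`. -/
def priorSuccess {Z : Type*} [MeasurableSpace Z] (π : Measure Z) (ρ : Z → Z → ℝ) (η : ℝ) :
    ℝ≥0∞ :=
  ⨆ z₀ : Z, π {z | ρ z z₀ ≤ η}

/-- The blow-up function `B_κ(μ, ν) = sup {μ(E) : E an event with ν(E) ≤ κ}`. -/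
def blowUp {Ω : Type*} [MeasurableSpace Ω] (κ : ℝ≥0∞) (μ ν : Measure Ω) : ℝ≥0∞ :=
  ⨆ (E : Set Ω) (_ : MeasurableSet E) (_ : ν E ≤ κ), μ E

/-- A mechanism `M` (sending a dataset, i.e. a finite multiset of points, to the law of its output)
is `(η, γ)`-reconstruction robust with respect to the prior `π` and the error function `ρ`:
for every fixed dataset `D` and every attack `R`, the probability that `ρ(Z, R(w)) ≤ η`, where
first `Z ∼ π` and then `w ∼ M(D ∪ {Z})`, is at most `γ`. -/
def IsReRo {Z W : Type*} [MeasurableSpace Z] [MeasurableSpace W]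
    (M : Multiset Z → Measure W) (π : Measure Z) (ρ : Z → Z → ℝ) (η : ℝ) (γ : ℝ≥0∞) : Prop :=
  ∀ (D : Multiset Z) (R : W → Z), Measurable R →
    ∫⁻ z, M (z ::ₘ D) {w | ρ z (R w) ≤ η} ∂π ≤ γ

/-! ### DP-SGD -/

/-- The isotropic Gaussian `N(m, s² I)` on `ℝⁿ`: the law of `m + s ξ` with `ξ` standard Gaussian. -/
def isoGaussian {n : ℕ} (m : EuclideanSpace ℝ (Fin n)) (s : ℝ) :
    Measure (EuclideanSpace ℝ (Fin n)) :=
  (stdGaussian (EuclideanSpace ℝ (Fin n))).map (fun ξ => m + s • ξ)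

/-- `L²`-clipping: `clip_C(v) = v / max{1, ‖v‖ / C}`. -/
def clip {d : ℕ} (C : ℝ) (v : EuclideanSpace ℝ (Fin d)) : EuclideanSpace ℝ (Fin d) :=
  (max 1 (‖v‖ / C))⁻¹ • v

/-- The law of the privatized gradient of the loss `ℓ` at the parameters `θ`:
a mini-batch `B` is drawn by including each point of `D` independently with probability `q`
(`Multiset.powerset` lists the sub-multisets with multiplicity, that is, one for each subset of the
positions of `D`), the clipped gradients of its points are summed, and noise `N(0, C² σ² I)` is
added. (At a point where `ℓ` is not differentiable in `θ`, `gradient` is `0`.) -/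
def privGrad {Z : Type*} {d : ℕ} (ℓ : EuclideanSpace ℝ (Fin d) → Z → ℝ) (C σ q : ℝ)
    (D : Multiset Z) (θ : EuclideanSpace ℝ (Fin d)) : Measure (EuclideanSpace ℝ (Fin d)) :=
  (D.powerset.map fun B =>
    ENNReal.ofReal (q ^ B.card * (1 - q) ^ (D.card - B.card)) •
      isoGaussian ((B.map fun z => clip C (gradient (fun θ' => ℓ θ' z) θ)).sum) (C * σ)).sum

/-- The law of the sequence `(g_0, …, g_{T-1})` of all intermediate privatized gradients of DP-SGD,
run on `D` for `T` steps from the parameters `θ` with step sizes `lr 0, lr 1, …`: at each step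
`g_t` is drawn from `privGrad` at the current parameters `θ_t` (with fresh randomness), and
`θ_{t+1} = θ_t - lr t • g_t`. -/
def dpsgd {Z : Type*} {d : ℕ} (ℓ : EuclideanSpace ℝ (Fin d) → Z → ℝ) (C σ q : ℝ)
    (D : Multiset Z) :
    (T : ℕ) → (lr : ℕ → ℝ) → (θ : EuclideanSpace ℝ (Fin d)) →
      Measure (Fin T → EuclideanSpace ℝ (Fin d))
  | 0, _, _ => Measure.dirac Fin.elim0
  | T + 1, lr, θ =>
      (privGrad ℓ C σ q D θ).bind fun g =>
        (dpsgd ℓ C σ q D T (fun t => lr (t + 1)) (θ - lr 0 • g)).map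
          (fun gs : Fin T → EuclideanSpace ℝ (Fin d) =>
            (Fin.cons g gs : Fin (T + 1) → EuclideanSpace ℝ (Fin d)))

/-! ### The dominating pair -/

/-- `ν_{T,σ} = N(0, σ² I_T)`. -/
def nuDom (T : ℕ) (σ : ℝ) : Measure (EuclideanSpace ℝ (Fin T)) :=
  isoGaussian 0 σ

/-- `μ_{T,σ,q} = ∑_{w ∈ {0,1}^T} Pr[B(q,T) = w] N(w, σ² I_T)`, where the coordinates of `B(q,T)` are
independent Bernoulli variables with success probability `q`. -/
def muDom (T : ℕ) (σ q : ℝ) : Measure (EuclideanSpace ℝ (Fin T)) :=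
  ∑ w : Fin T → Bool,
    ENNReal.ofReal (∏ t, if w t then q else 1 - q) •
      isoGaussian (WithLp.toLp 2 fun t => if w t then (1 : ℝ) else 0) σ

/-! ### Well-definedness

`Measure.bind` and the integral over the prior are meaningful here because the laws involved are
probability measures that depend measurably on the parameters and on the target point. -/

/-- `N(m, s² I)` is a probability measure. -/
instance isProbabilityMeasure_isoGaussian {n : ℕ} (m : EuclideanSpace ℝ (Fin n)) (s : ℝ) :
    IsProbabilityMeasure (isoGaussian m s) :=
  Measure.isProbabilityMeasure_map (by fun_prop)

lemma measurable_isoGaussian {n : ℕ} (s : ℝ) :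
    Measurable (fun m : EuclideanSpace ℝ (Fin n) => isoGaussian m s) := by
  have h : (fun m : EuclideanSpace ℝ (Fin n) => isoGaussian m s) = fun m =>
      ((stdGaussian (EuclideanSpace ℝ (Fin n))).map (Prod.mk m)).map
        (fun p : EuclideanSpace ℝ (Fin n) × EuclideanSpace ℝ (Fin n) => p.1 + s • p.2) := by
    funext m
    rw [Measure.map_map (by fun_prop) (by fun_prop)]
    rfl
  rw [h]
  exact (Measure.measurable_map _ (by fun_prop)).comp Measurable.map_prodMk_left

lemma measurable_clip {d : ℕ} (C : ℝ) : Measurable (clip C : EuclideanSpace ℝ (Fin d) → _) := by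
  unfold clip; fun_prop

/-- The privatized gradient is a probability measure. -/
lemma isProbabilityMeasure_privGrad {Z : Type*} {d : ℕ}
    (ℓ : EuclideanSpace ℝ (Fin d) → Z → ℝ) (C σ q : ℝ)
    (hq : q ∈ Set.Icc (0 : ℝ) 1) (D : Multiset Z) (θ : EuclideanSpace ℝ (Fin d)) :
    IsProbabilityMeasure (privGrad ℓ C σ q D θ) := by
  have key : ∀ (D : Multiset Z) (f : Multiset Z → Measure (EuclideanSpace ℝ (Fin d))),
      (∀ B, f B Set.univ = 1) → ((D.powerset.map fun B =>
        ENNReal.ofReal (q ^ B.card * (1 - q) ^ (D.card - B.card)) • f B).sum) Set.univ = 1 := by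
    intro D f hf
    have h1 : ∀ (S : Multiset (Multiset Z)) (c : Multiset Z → ℝ), (∀ B, 0 ≤ c B) →
        ((S.map fun B => ENNReal.ofReal (c B) • f B).sum) Set.univ =
          ENNReal.ofReal ((S.map c).sum) := by
      intro S c hc
      induction S using Multiset.induction_on with
      | empty => simp
      | cons B S ih =>
        rw [Multiset.map_cons, Multiset.sum_cons, Measure.add_apply, ih, Multiset.map_cons,
          Multiset.sum_cons, ENNReal.ofReal_add (hc B)
            (Multiset.sum_nonneg (by
              intro x hx
              obtain ⟨b, -, rfl⟩ := Multiset.mem_map.1 hx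
              exact hc b))]
        simp [hf]
    rw [h1 _ _ (fun B => mul_nonneg (pow_nonneg hq.1 _) (pow_nonneg (by linarith [hq.2]) _))]
    have h3 : (D.powerset.map fun B => q ^ B.card * (1 - q) ^ (D.card - B.card)).sum = 1 := by
      have : ∀ n : ℕ, ∀ D : Multiset Z, D.card = n →
          (D.powerset.map fun B => q ^ B.card * (1 - q) ^ (D.card - B.card)).sum = 1 := by
        intro n D _
        induction D using Multiset.induction_on generalizing n with
        | empty => simp
        | cons a D ih =>
          rw [Multiset.powerset_cons, Multiset.map_add, Multiset.sum_add, Multiset.map_map]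
          have e1 : (D.powerset.map fun B => q ^ B.card * (1 - q) ^ ((a ::ₘ D).card - B.card)).sum
              = (1 - q) * (D.powerset.map fun B =>
                  q ^ B.card * (1 - q) ^ (D.card - B.card)).sum := by
            rw [← Multiset.sum_map_mul_left]
            congr 1
            apply Multiset.map_congr rfl
            intro B hB
            have := Multiset.card_le_card (Multiset.mem_powerset.1 hB)
            rw [Multiset.card_cons, Nat.succ_sub this, pow_succ]
            ring
          have e2 : (D.powerset.map ((fun B : Multiset Z =>
              q ^ B.card * (1 - q) ^ ((a ::ₘ D).card - B.card)) ∘ Multiset.cons a)).sum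
              = q * (D.powerset.map fun B =>
                  q ^ B.card * (1 - q) ^ (D.card - B.card)).sum := by
            rw [← Multiset.sum_map_mul_left]
            congr 1
            apply Multiset.map_congr rfl
            intro B hB
            simp [pow_succ]
            ring
          rw [e1, e2, ih D.card rfl]
          ring
      exact this _ D rfl
    rw [h3]; simp
  exact ⟨key D _ fun B => measure_univ⟩

lemma measurable_privGrad_cons {Z : Type*} [MeasurableSpace Z] {d : ℕ}
    (ℓ : EuclideanSpace ℝ (Fin d) → Z → ℝ)
    (hℓ : Measurable fun p : EuclideanSpace ℝ (Fin d) × Z =>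
      gradient (fun θ' => ℓ θ' p.2) p.1) (C σ q : ℝ) (D : Multiset Z) :
    Measurable fun p : EuclideanSpace ℝ (Fin d) × Z => privGrad ℓ C σ q (p.2 ::ₘ D) p.1 := by
  have hg : ∀ z : Z, Measurable fun p : EuclideanSpace ℝ (Fin d) × Z =>
      clip C (gradient (fun θ' => ℓ θ' z) p.1) := fun z =>
    (measurable_clip C).comp (hℓ.comp (measurable_fst.prodMk measurable_const))
  have hB : ∀ B : Multiset Z, Measurable fun p : EuclideanSpace ℝ (Fin d) × Z =>
      (B.map fun z => clip C (gradient (fun θ' => ℓ θ' z) p.1)).sum := by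
    intro B
    induction B using Multiset.induction_on with
    | empty => simp
    | cons a B ih =>
      simp only [Multiset.map_cons, Multiset.sum_cons]
      exact (hg a).add ih
  have hsum : ∀ (S : Multiset (Multiset Z))
      (F : Multiset Z → EuclideanSpace ℝ (Fin d) × Z → Measure (EuclideanSpace ℝ (Fin d))),
      (∀ B, Measurable (F B)) → Measurable fun p => (S.map fun B => F B p).sum := by
    intro S F hF
    refine Measure.measurable_of_measurable_coe _ fun s hs => ?_
    induction S using Multiset.induction_on with
    | empty => simp
    | cons B S ih =>
      simp only [Multiset.map_cons, Multiset.sum_cons, Measure.add_apply]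
      exact ((Measure.measurable_coe hs).comp (hF B)).add ih
  have hsm : ∀ (c : ℝ≥0∞)
      (f : EuclideanSpace ℝ (Fin d) × Z → Measure (EuclideanSpace ℝ (Fin d))),
      Measurable f → Measurable fun p => c • f p := by
    intro c f hf
    refine Measure.measurable_of_measurable_coe _ fun s hs => ?_
    simp only [Measure.smul_apply, smul_eq_mul]
    exact ((Measure.measurable_coe hs).comp hf).const_mul c
  simp only [privGrad, Multiset.powerset_cons, Multiset.map_add, Multiset.sum_add,
    Multiset.map_map, Function.comp_def, Multiset.map_cons, Multiset.sum_cons, Multiset.card_cons]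
  have hadd : ∀ f g : EuclideanSpace ℝ (Fin d) × Z → Measure (EuclideanSpace ℝ (Fin d)),
      Measurable f → Measurable g → Measurable fun p => f p + g p := by
    intro f g hf hg
    refine Measure.measurable_of_measurable_coe _ fun s hs => ?_
    simp only [Measure.add_apply]
    exact ((Measure.measurable_coe hs).comp hf).add ((Measure.measurable_coe hs).comp hg)
  refine hadd _ _ (hsum _ _ fun B => hsm _ _ ?_) (hsum _ _ fun B => hsm _ _ ?_)
  · exact (measurable_isoGaussian _).comp (hB B)
  · exact (measurable_isoGaussian _).comp (((measurable_clip C).comp hℓ).add (hB B))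

/-- The law of the transcript is a probability measure that depends measurably on the target
point and on the initial parameters. -/
theorem dpsgd_wellDefined {Z : Type*} [MeasurableSpace Z] {d : ℕ}
    (ℓ : EuclideanSpace ℝ (Fin d) → Z → ℝ)
    (hℓ : Measurable fun p : EuclideanSpace ℝ (Fin d) × Z =>
      gradient (fun θ' => ℓ θ' p.2) p.1) (C σ q : ℝ) (hq : q ∈ Set.Icc (0 : ℝ) 1)
    (D : Multiset Z) (T : ℕ) (lr : ℕ → ℝ) :
    (Measurable fun p : EuclideanSpace ℝ (Fin d) × Z => dpsgd ℓ C σ q (p.2 ::ₘ D) T lr p.1) ∧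
      ∀ z θ, IsProbabilityMeasure (dpsgd ℓ C σ q (z ::ₘ D) T lr θ) := by
  induction T generalizing lr with
  | zero => exact ⟨measurable_const, fun z θ => by unfold dpsgd; infer_instance⟩
  | succ T ih =>
    obtain ⟨hm, hp⟩ := ih (fun t => lr (t + 1))
    let κ₁ : Kernel (EuclideanSpace ℝ (Fin d) × Z) (EuclideanSpace ℝ (Fin d)) :=
      ⟨_, measurable_privGrad_cons ℓ hℓ C σ q D⟩
    let κ₀ : Kernel (EuclideanSpace ℝ (Fin d) × Z) (Fin T → EuclideanSpace ℝ (Fin d)) := ⟨_, hm⟩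
    have i1 : IsMarkovKernel κ₁ := ⟨fun p => isProbabilityMeasure_privGrad ℓ C σ q hq _ _⟩
    have i0 : IsMarkovKernel κ₀ := ⟨fun p => hp _ _⟩
    have hup : Measurable fun p : (EuclideanSpace ℝ (Fin d) × Z) × EuclideanSpace ℝ (Fin d) =>
      (p.1.1 - lr 0 • p.2, p.1.2) := by fun_prop
    let κ₂ := κ₀.comap _ hup
    have hcons : Measurable fun p : EuclideanSpace ℝ (Fin d) × (Fin T → EuclideanSpace ℝ (Fin d)) =>
        (Fin.cons p.1 p.2 : Fin (T + 1) → EuclideanSpace ℝ (Fin d)) := by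
      refine measurable_pi_iff.2 fun i => ?_
      refine Fin.cases ?_ (fun j => ?_) i
      · simpa using measurable_fst
      · simp only [Fin.cons_succ]
        exact (measurable_pi_apply j).comp measurable_snd
    have heq : ∀ p : EuclideanSpace ℝ (Fin d) × Z,
        dpsgd ℓ C σ q (p.2 ::ₘ D) (T + 1) lr p.1 = ((κ₁ ⊗ₖ κ₂).map fun p =>
          (Fin.cons p.1 p.2 : Fin (T + 1) → EuclideanSpace ℝ (Fin d))) p := by
      intro p
      ext s hs
      have hmf : Measurable fun g => (dpsgd ℓ C σ q (p.2 ::ₘ D) T (fun t => lr (t + 1))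
          (p.1 - lr 0 • g)).map (fun gs : Fin T → EuclideanSpace ℝ (Fin d) =>
            (Fin.cons g gs : Fin (T + 1) → EuclideanSpace ℝ (Fin d))) := by
        refine Measure.measurable_of_measurable_coe _ fun s hs => ?_
        have : Measurable fun g => κ₂ (p, g) (Prod.mk g ⁻¹'
            ((fun p : EuclideanSpace ℝ (Fin d) × (Fin T → EuclideanSpace ℝ (Fin d)) =>
        (Fin.cons p.1 p.2 : Fin (T + 1) → EuclideanSpace ℝ (Fin d))) ⁻¹' s)) :=
          Kernel.measurable_kernel_prodMk_left' (η := κ₂) (hcons hs) p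
        convert this using 2 with g
        exact Measure.map_apply (f := fun gs => Fin.cons g gs)
          (hcons.comp measurable_prodMk_left) hs
      rw [Kernel.map_apply' _ hcons _ hs, Kernel.compProd_apply (hcons hs), dpsgd,
        Measure.bind_apply hs hmf.aemeasurable]
      refine lintegral_congr fun g => ?_
      exact Measure.map_apply (f := fun gs => Fin.cons g gs)
        (hcons.comp measurable_prodMk_left) hs
    refine ⟨?_, fun z θ => ?_⟩
    · simp_rw [heq]; exact Kernel.measurable _
    · rw [heq (θ, z)]
      have := Kernel.IsMarkovKernel.map (κ₁ ⊗ₖ κ₂) hcons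
      infer_instance

end

/-! Fix the target point `z`. If `v` is its clipped gradient at the current parameters, then `‖v‖ ≤
C`, so the noise `N(0, C²σ²I)` splits into independent parts `x • v` with `x ∼ N(0, σ²)` and a
Gaussian of covariance `C²σ²I - σ²vvᵀ`, which is positive semidefinite. Including `z` in the batch
only moves the mean of the scalar score `x` from 0 to 1. So one step is a randomized function of a
score whose law is `N(0, σ²)` without `z` and `(1 - q)N(0, σ²) + qN(1, σ²)` with it
(`scoreOut_bind_scoredGrad`, `scoreIn_bind_scoredGrad`). The function depends on the past through
`θ`, but the law of the score does not. Hence the whole transcript is the image of `T` independent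
scores under one Markov kernel, and the score vector has law `nuDom` or `muDom`
(`exists_kernel_dpsgd`).

For each `z`, the success of the attack is therefore the power under `muDom` of a randomized test
`φ_z`, whose size under `nuDom` is the success of the attack when `z` is absent. In the latter case
the guess is independent of `Z`, so the size averaged over the prior is at most `κ`; individual
sizes may exceed `κ`. The average is handled by concavity of the optimal power as a function of
size: `exists_blowUp_multiplier` gives a supporting line at `κ`, `∫ φ dμ ≤ B_κ + c (∫ φ dν - κ)`,
with one slope `c` for all tests. Integrating it over `z` gives the bound. -/

noncomputable section

/-! ### Neyman–Pearson -/

section NeymanPearson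

variable {Ω : Type*} [MeasurableSpace Ω]

/-- Existence of quantiles of an extended nonnegative function. -/
lemma exists_quantile (μ : Measure Ω) [IsFiniteMeasure μ] {h : Ω → ℝ≥0∞} (hh : Measurable h)
    {κ : ℝ≥0∞} (hκ : κ ≤ μ Set.univ) :
    ∃ c, μ {x | c < h x} ≤ κ ∧ κ ≤ μ {x | c ≤ h x} := by
  -- The quantile is the infimum of the levels whose strict upper tail has mass at most `κ`.
  -- Continuity of `μ` from below along levels decreasing to it gives the first bound, continuity
  -- from above along levels increasing to it gives the second.
  set S : Set ℝ≥0∞ := {c | μ {x | c < h x} ≤ κ} with hS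
  have hne : S.Nonempty := ⟨∞, by simp [hS]⟩
  refine ⟨sInf S, ?_, ?_⟩
  · obtain ⟨u, hu, hlim, huS⟩ := exists_seq_tendsto_sInf hne (OrderBot.bddBelow S)
    have hset : {x | sInf S < h x} = ⋃ n, {x | u n < h x} := by
      ext x
      simp only [Set.mem_ofPred_eq, Set.mem_iUnion]
      constructor
      · intro hx
        exact ((hlim.eventually (gt_mem_nhds hx)).exists)
      · rintro ⟨n, hn⟩
        exact (sInf_le (huS n)).trans_lt hn
    rw [hset]
    refine le_of_tendsto' (tendsto_measure_iUnion_atTop (μ := μ) ?_) fun n => huS n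
    exact fun m n hmn x hx => (hu hmn).trans_lt hx
  -- No level lies below 0, but there the closed tail is the whole space, which is where the bound
  -- on `κ` enters.
  · rcases eq_or_ne (sInf S) 0 with h0 | h0
    · simpa [h0] using hκ
    · obtain ⟨u, hu, hlt, hlim⟩ := exists_seq_strictMono_tendsto' (bot_lt_iff_ne_bot.2 h0)
      have hset : {x | sInf S ≤ h x} = ⋂ n, {x | u n < h x} := by
        ext x
        simp only [Set.mem_ofPred_eq, Set.mem_iInter]
        exact ⟨fun hx n => (hlt n).2.trans_le hx, fun hx => le_of_tendsto' hlim fun n => (hx n).le⟩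
      rw [hset]
      refine ge_of_tendsto' (tendsto_measure_iInter_atTop (μ := μ)
        (fun n => (measurableSet_lt measurable_const hh).nullMeasurableSet) ?_
        ⟨0, measure_ne_top _ _⟩) fun n => ?_
      · exact fun m n hmn x hx => (hu.monotone hmn).trans_lt hx
      · exact (not_le.1 fun hc => (hlt n).2.not_ge (sInf_le hc)).le

/-- Neyman–Pearson: if some measurable function has null level sets under `ν`, then a likelihood
ratio test of size exactly `κ` exists, and it is optimal among all randomized tests. -/
lemma exists_blowUp_multiplier (μ ν : Measure Ω) [IsFiniteMeasure μ] [IsProbabilityMeasure ν]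
    (hμν : μ ≪ ν) {h : Ω → ℝ≥0∞} (hh : Measurable h) (hnull : ∀ s, ν {x | h x = s} = 0)
    {κ : ℝ≥0∞} (h0 : κ ≠ 0) (h1 : κ ≤ 1) :
    ∃ c : ℝ≥0∞, c ≠ ∞ ∧ ∀ φ : Ω → ℝ≥0∞, Measurable φ → (∀ x, φ x ≤ 1) →
      ∫⁻ x, φ x ∂μ + c * κ ≤ blowUp κ μ ν + c * ∫⁻ x, φ x ∂ν := by
  set f := μ.rnDeriv ν with hf
  have hfm : Measurable f := Measure.measurable_rnDeriv μ ν
  have hμ : μ = ν.withDensity f := (Measure.withDensity_rnDeriv_eq μ ν hμν).symm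
  obtain ⟨c, hc1, hc2⟩ := exists_quantile ν hfm (κ := κ) (by simpa using h1)
  have hm1 : MeasurableSet {x | c < f x} := measurableSet_lt measurable_const hfm
  have hm2 : MeasurableSet {x | f x = c} := hfm (measurableSet_singleton c)
  have hdisj : Disjoint {x | c < f x} {x | f x = c} :=
    Set.disjoint_left.2 fun x (hx : c < f x) (hx' : f x = c) => hx.ne' hx'
  have hsplit : ν {x | c ≤ f x} = ν {x | c < f x} + ν {x | f x = c} := by
    rw [← measure_union hdisj hm2]
    congr 1
    ext x
    simp [le_iff_lt_or_eq, eq_comm]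
  -- The level set `f = c` of the likelihood ratio may have positive mass. A second quantile, of the
  -- tie-breaking function `h` on that set, cuts out exactly the missing mass, so a non-randomized
  -- test attains size `κ`.
  obtain ⟨s, hs1, hs2⟩ := exists_quantile (ν.restrict {x | f x = c}) hh
    (κ := κ - ν {x | c < f x}) (by
      rw [Measure.restrict_apply_univ]
      exact tsub_le_iff_left.2 (hsplit ▸ hc2))
  have hms : MeasurableSet {x | s < h x} := measurableSet_lt measurable_const hh
  have hs : ν.restrict {x | f x = c} {x | s ≤ h x} = ν.restrict {x | f x = c} {x | s < h x} := by
    refine le_antisymm ?_ (measure_mono fun x (hx : s < h x) => hx.le)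
    calc _ ≤ ν.restrict {x | f x = c} ({x | s < h x} ∪ {x | h x = s}) :=
          measure_mono fun x (hx : s ≤ h x) => hx.lt_or_eq.imp id Eq.symm
      _ ≤ _ := measure_union_le _ _
      _ ≤ ν.restrict {x | f x = c} {x | s < h x} + ν {x | h x = s} := by
          gcongr; exact Measure.restrict_le_self
      _ = _ := by rw [hnull, add_zero]
  have hseq : ν ({x | s < h x} ∩ {x | f x = c}) = κ - ν {x | c < f x} := by
    rw [← Measure.restrict_apply hms]
    exact le_antisymm hs1 (hs ▸ hs2)
  set E := {x | c < f x} ∪ ({x | s < h x} ∩ {x | f x = c}) with hE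
  have hEm : MeasurableSet E := hm1.union (hms.inter hm2)
  have hEν : ν E = κ := by
    rw [hE, measure_union (hdisj.mono_right Set.inter_subset_right) (hms.inter hm2), hseq,
      add_tsub_cancel_of_le hc1]
  have hfin : ∀ᵐ x ∂ν, f x < ∞ := Measure.rnDeriv_lt_top μ ν
  -- An infinite threshold would force `κ ≤ ν {f = ∞} = 0`.
  have hctop : c ≠ ∞ := by
    rintro rfl
    refine h0 (le_antisymm (hc2.trans (le_of_eq ?_)) bot_le)
    simpa [ae_iff] using hfin
  refine ⟨c, hctop, fun φ hφ hφ1 => ?_⟩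
  have hle : μ E ≤ blowUp κ μ ν := by
    unfold blowUp
    exact le_iSup_of_le E (le_iSup_of_le hEm (le_iSup_of_le hEν.le le_rfl))
  refine le_trans ?_ (add_le_add_left hle _)
  have e1 : ∫⁻ x, φ x ∂μ = ∫⁻ x, f x * φ x ∂ν := by
    rw [hμ, lintegral_withDensity_eq_lintegral_mul _ hfm hφ]; rfl
  have e2 : c * κ = ∫⁻ x, E.indicator (fun _ => c) x ∂ν := by
    rw [lintegral_indicator_const hEm, hEν]
  have e3 : μ E = ∫⁻ x, E.indicator f x ∂ν := by
    rw [lintegral_indicator hEm, ← withDensity_apply _ hEm, ← hμ]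
  rw [e1, e2, e3, ← lintegral_const_mul c hφ, ← lintegral_add_left (f := fun x => f x * φ x) (hfm.mul hφ),
    ← lintegral_add_left (hfm.indicator hEm)]
  -- Pointwise this is `(f - c)(1_E - φ) ≥ 0`, written without subtraction: `f ≥ c` on `E`, `f ≤ c`
  -- off `E`, and `0 ≤ φ ≤ 1`.
  refine lintegral_mono_ae (hfin.mono fun x hx => ?_)
  by_cases hxE : x ∈ E
  · have hcf : c ≤ f x := by
      rcases hxE with hx' | hx'
      · exact le_of_lt hx'
      · exact le_of_eq hx'.2.symm
    simp only [Set.indicator_of_mem hxE]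
    obtain ⟨d, hd⟩ := exists_add_of_le hcf
    rw [hd, add_mul]
    calc c * φ x + d * φ x + c ≤ c * φ x + d * 1 + c := by gcongr; exact hφ1 x
      _ = c + d + c * φ x := by ring
  · have hcf : f x ≤ c := not_lt.1 fun hlt => hxE (Or.inl hlt)
    simp only [Set.indicator_of_notMem hxE, add_zero, zero_add]
    gcongr

end NeymanPearson

/-! ### One step as a randomized function of a Gaussian score -/

section Shear

variable {d : ℕ}

/-- A square root of `I - w wᵀ` for `‖w‖ ≤ 1`. -/
def shrink (w ξ : EuclideanSpace ℝ (Fin d)) : EuclideanSpace ℝ (Fin d) :=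
  ξ - ((1 + √(1 - ‖w‖ ^ 2))⁻¹ * inner ℝ w ξ) • w

lemma inner_shrink (w x y : EuclideanSpace ℝ (Fin d)) :
    inner ℝ (shrink w x) y = inner ℝ x (shrink w y) := by
  simp only [shrink, inner_sub_left, inner_sub_right, real_inner_smul_left, real_inner_smul_right,
    real_inner_comm w x]
  ring

/-- With `r = √(1 - ‖w‖²)`, the square of `I - (1 + r)⁻¹ wwᵀ` is `I - wwᵀ`, because `‖w‖² = (1 -
r)(1 + r)`. The coefficient equals `(1 - r) / ‖w‖²` but remains meaningful at `w = 0`. -/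
lemma norm_shrink_sq {w : EuclideanSpace ℝ (Fin d)} (hw : ‖w‖ ≤ 1)
    (t : EuclideanSpace ℝ (Fin d)) : ‖shrink w t‖ ^ 2 = ‖t‖ ^ 2 - inner ℝ w t ^ 2 := by
  have h1 : 0 ≤ 1 - ‖w‖ ^ 2 := by nlinarith [norm_nonneg w]
  set r := √(1 - ‖w‖ ^ 2) with hr
  have hr0 : 0 ≤ r := Real.sqrt_nonneg _
  have hr2 : r ^ 2 = 1 - ‖w‖ ^ 2 := Real.sq_sqrt h1
  have hw2 : ‖w‖ ^ 2 = (1 - r) * (1 + r) := by linarith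
  have hr1 : 1 + r ≠ 0 := by positivity
  rw [shrink, ← hr, norm_sub_sq_real, real_inner_smul_right, real_inner_comm w t, norm_smul,
    mul_pow, hw2, Real.norm_eq_abs, sq_abs]
  field_simp
  ring

/-- The law of the privatized sum with mean `m` and partial noise `C σ (I - w wᵀ)^{1/2} ξ`. -/
def shearNoise (s : ℝ) (w m : EuclideanSpace ℝ (Fin d)) : Measure (EuclideanSpace ℝ (Fin d)) :=
  (stdGaussian (EuclideanSpace ℝ (Fin d))).map fun ξ => m + s • shrink w ξ

lemma measurable_map_prodMk {α β γ : Type*} [MeasurableSpace α] [MeasurableSpace β]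
    [MeasurableSpace γ] (μ : Measure β) [SFinite μ] {F : α × β → γ} (hF : Measurable F) :
    Measurable fun a => μ.map fun b => F (a, b) := by
  have h : (fun a => μ.map fun b => F (a, b)) = fun a => (μ.map (Prod.mk a)).map F := by
    funext a
    rw [Measure.map_map hF measurable_prodMk_left]
    rfl
  rw [h]
  exact (Measure.measurable_map _ hF).comp Measurable.map_prodMk_left

lemma measurable_shearNoise (s : ℝ) :
    Measurable fun p : EuclideanSpace ℝ (Fin d) × EuclideanSpace ℝ (Fin d) =>
      shearNoise s p.1 p.2 := by
  unfold shearNoise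
  refine measurable_map_prodMk (F := fun p : (EuclideanSpace ℝ (Fin d) × EuclideanSpace ℝ (Fin d)) ×
    EuclideanSpace ℝ (Fin d) => p.1.2 + s • shrink p.1.1 p.2) _ ?_
  unfold shrink
  fun_prop

instance isProbabilityMeasure_shearNoise (s : ℝ) (w m : EuclideanSpace ℝ (Fin d)) :
    IsProbabilityMeasure (shearNoise s w m) :=
  Measure.isProbabilityMeasure_map (by unfold shrink; fun_prop)

lemma bind_translate_eq_conv {E : Type*} [NormedAddCommGroup E] [NormedSpace ℝ E]
    [MeasurableSpace E] [BorelSpace E] [SecondCountableTopology E] (γ : Measure ℝ)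
    [IsProbabilityMeasure γ] (ν : Measure E) [IsProbabilityMeasure ν] (v : E) :
    γ.bind (fun x => ν.map fun y => x • v + y) = (γ.map fun x => x • v) ∗ ν := by
  ext A hA
  have hm : Measurable fun x : ℝ => ν.map fun y => x • v + y :=
    measurable_map_prodMk (F := fun p : ℝ × E => p.1 • v + p.2) ν (by fun_prop)
  have hadd : Measurable fun p : E × E => p.1 + p.2 := by fun_prop
  rw [Measure.bind_apply hA hm.aemeasurable, Measure.conv, Measure.map_apply hadd hA,
    Measure.prod_apply (hadd hA), lintegral_map (measurable_measure_prodMk_left (hadd hA))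
      (by fun_prop)]
  refine lintegral_congr fun x => ?_
  rw [Measure.map_apply (by fun_prop) hA]
  rfl

lemma charFun_isoGaussian (m : EuclideanSpace ℝ (Fin d)) (s : ℝ) (t : EuclideanSpace ℝ (Fin d)) :
    charFun (isoGaussian m s) t =
      Complex.exp ((inner ℝ m t : ℝ) * Complex.I - s ^ 2 * ‖t‖ ^ 2 / 2) := by
  have h : isoGaussian m s =
      ((stdGaussian (EuclideanSpace ℝ (Fin d))).map (s • ·)).map (m + ·) := by
    rw [Measure.map_map (by fun_prop) (by fun_prop)]
    rfl
  rw [h, charFun_map_const_add, charFun_map_smul, charFun_stdGaussian, ← Complex.exp_add]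
  congr 1
  rw [norm_smul, Real.norm_eq_abs, Complex.ofReal_mul, mul_pow, ← Complex.ofReal_pow |s|, sq_abs]
  push_cast
  ring

lemma charFun_shearNoise (s : ℝ) {w : EuclideanSpace ℝ (Fin d)} (hw : ‖w‖ ≤ 1)
    (m t : EuclideanSpace ℝ (Fin d)) :
    charFun (shearNoise s w m) t = Complex.exp ((inner ℝ m t : ℝ) * Complex.I -
      s ^ 2 * (‖t‖ ^ 2 - (inner ℝ w t : ℝ) ^ 2) / 2) := by
  have hsh : Measurable (shrink w) := by unfold shrink; fun_prop
  have h : shearNoise s w m =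
      (((stdGaussian (EuclideanSpace ℝ (Fin d))).map (shrink w)).map (s • ·)).map (m + ·) := by
    rw [Measure.map_map (by fun_prop) (by fun_prop), Measure.map_map (by fun_prop) hsh]
    rfl
  -- `shrink w` is self-adjoint, so it can be moved from the noise onto the frequency.
  have hS : charFun ((stdGaussian (EuclideanSpace ℝ (Fin d))).map (shrink w)) (s • t) =
      charFun (stdGaussian (EuclideanSpace ℝ (Fin d))) (shrink w (s • t)) := by
    rw [charFun_apply, charFun_apply, integral_map hsh.aemeasurable (by fun_prop)]
    simp_rw [inner_shrink]
  rw [h, charFun_map_const_add, charFun_map_smul, hS, charFun_stdGaussian, ← Complex.exp_add]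
  congr 1
  rw [← Complex.ofReal_pow, norm_shrink_sq hw, norm_smul, real_inner_smul_right, mul_pow,
    Real.norm_eq_abs, sq_abs]
  push_cast
  ring

/-- If the score is `N(b, σ²)`, then adding `score • v` to the partial noise gives the isotropic
Gaussian with mean shifted by `b • v`. -/
lemma bind_shearNoise {C : ℝ} (hC : 0 < C) {σ : ℝ}
    (m : EuclideanSpace ℝ (Fin d)) {v : EuclideanSpace ℝ (Fin d)} (hv : ‖v‖ ≤ C) (b : ℝ) :
    (gaussianReal b (.mk (σ ^ 2) (sq_nonneg _))).bind
        (fun x => shearNoise (C * σ) (C⁻¹ • v) (m + x • v)) =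
      isoGaussian (m + b • v) (C * σ) := by
  have hw : ‖C⁻¹ • v‖ ≤ 1 := by
    rw [norm_smul, norm_inv, Real.norm_of_nonneg hC.le, inv_mul_le_iff₀ hC]
    simpa using hv
  have hsh : Measurable (shrink (C⁻¹ • v)) := by unfold shrink; fun_prop
  have h : ∀ x : ℝ, shearNoise (C * σ) (C⁻¹ • v) (m + x • v) =
      (shearNoise (C * σ) (C⁻¹ • v) m).map fun y => x • v + y := by
    intro x
    unfold shearNoise
    rw [Measure.map_map (by fun_prop) (by fun_prop)]
    congr 1
    funext ξ
    simp only [Function.comp_apply]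
    abel
  simp_rw [h]
  rw [bind_translate_eq_conv]
  have := Measure.isProbabilityMeasure_map (μ := gaussianReal b (.mk (σ ^ 2) (sq_nonneg _)))
    (f := fun x : ℝ => x • v) (by fun_prop)
  refine Measure.ext_of_charFun (funext fun t => ?_)
  have hg : charFun ((gaussianReal b (.mk (σ ^ 2) (sq_nonneg _))).map fun x : ℝ => x • v) t =
      charFun (gaussianReal b (.mk (σ ^ 2) (sq_nonneg _))) (inner ℝ v t) := by
    rw [charFun_apply, integral_map (by fun_prop) (by fun_prop), charFun_apply_real]
    simp_rw [real_inner_smul_left]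
    push_cast
    simp_rw [mul_comm (inner ℝ v t : ℂ)]
  rw [charFun_conv, hg, charFun_gaussianReal, charFun_shearNoise _ hw, charFun_isoGaussian,
    ← Complex.exp_add]
  -- The score contributes the variance `σ²⟨v, t⟩²`, exactly what the partial noise lacks, namely
  -- `(Cσ)²⟨C⁻¹v, t⟩²`.
  congr 1
  rw [real_inner_smul_left, inner_add_left, real_inner_smul_left]
  have hC' : (C : ℂ) ≠ 0 := by exact_mod_cast hC.ne'
  push_cast
  field_simp
  ring

end Shear

/-! ### Mixtures and Markov kernels -/

section Mixture

variable {α β ι : Type*} [MeasurableSpace α] [MeasurableSpace β]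

lemma multisetSum_smul_apply (S : Multiset ι) (c : ι → ℝ≥0∞) (f : ι → Measure β) (A : Set β) :
    (S.map fun i => c i • f i).sum A = (S.map fun i => c i * f i A).sum := by
  induction S using Multiset.induction_on with
  | empty => simp
  | cons i S ih => simp [ih]

lemma measurable_multisetSum_smul (S : Multiset ι) (c : ι → ℝ≥0∞) {F : ι → α → Measure β}
    (hF : ∀ i, Measurable (F i)) : Measurable fun a => (S.map fun i => c i • F i a).sum := by
  refine Measure.measurable_of_measurable_coe _ fun A hA => ?_
  simp_rw [multisetSum_smul_apply]
  induction S using Multiset.induction_on with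
  | empty => simp
  | cons i S ih =>
    simp only [Multiset.map_cons, Multiset.sum_cons]
    exact (((Measure.measurable_coe hA).comp (hF i)).const_mul _).add ih

lemma bind_multisetSum_smul (γ : Measure α) (S : Multiset ι) (c : ι → ℝ≥0∞)
    {F : ι → α → Measure β} (hF : ∀ i, Measurable (F i)) :
    γ.bind (fun a => (S.map fun i => c i • F i a).sum) =
      (S.map fun i => c i • γ.bind (F i)).sum := by
  ext A hA
  rw [Measure.bind_apply hA (measurable_multisetSum_smul S c hF).aemeasurable,
    multisetSum_smul_apply]
  simp_rw [multisetSum_smul_apply]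
  induction S using Multiset.induction_on with
  | empty => simp
  | cons i S ih =>
    simp only [Multiset.map_cons, Multiset.sum_cons]
    have hm : Measurable fun a => F i a A := (Measure.measurable_coe hA).comp (hF i)
    rw [lintegral_add_left (hm.const_mul _), lintegral_const_mul _ hm, ih,
      Measure.bind_apply hA (hF i).aemeasurable]

lemma smul_add_smul_bind (a b : ℝ≥0∞) (γ₀ γ₁ : Measure α) {F : α → Measure β}
    (hF : Measurable F) :
    (a • γ₀ + b • γ₁).bind F = a • γ₀.bind F + b • γ₁.bind F := by
  ext A hA
  simp [Measure.bind_apply hA hF.aemeasurable, lintegral_add_measure]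

end Mixture

/-! ### A privatized gradient as a randomized function of a score -/

section Score

variable {Z : Type*} {d : ℕ}

/-- The score of the target point in the absence of that point: `N(0, σ²)`. -/
def scoreOut (σ : ℝ) : Measure ℝ := gaussianReal 0 (.mk (σ ^ 2) (sq_nonneg σ))

/-- The score of the target point in its presence: `(1 - q) N(0, σ²) + q N(1, σ²)`. -/
def scoreIn (σ q : ℝ) : Measure ℝ :=
  ENNReal.ofReal (1 - q) • scoreOut σ +
    ENNReal.ofReal q • gaussianReal 1 (.mk (σ ^ 2) (sq_nonneg σ))

instance isProbabilityMeasure_scoreOut (σ : ℝ) : IsProbabilityMeasure (scoreOut σ) := by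
  unfold scoreOut; infer_instance

lemma isProbabilityMeasure_scoreIn (σ : ℝ) {q : ℝ} (hq : q ∈ Set.Icc (0 : ℝ) 1) :
    IsProbabilityMeasure (scoreIn σ q) := by
  refine ⟨?_⟩
  simp only [scoreIn, Measure.add_apply, Measure.smul_apply, measure_univ, smul_eq_mul, mul_one]
  rw [← ENNReal.ofReal_add (by linarith [hq.2]) hq.1]
  simp

/-- The privatized gradient on `D` together with the target point `z`, given the score of `z`. -/
def scoredGrad (ℓ : EuclideanSpace ℝ (Fin d) → Z → ℝ) (C σ q : ℝ) (D : Multiset Z) (z : Z)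
    (p : EuclideanSpace ℝ (Fin d) × ℝ) : Measure (EuclideanSpace ℝ (Fin d)) :=
  (D.powerset.map fun B =>
    ENNReal.ofReal (q ^ B.card * (1 - q) ^ (D.card - B.card)) •
      shearNoise (C * σ) (C⁻¹ • clip C (gradient (fun θ' => ℓ θ' z) p.1))
        ((B.map fun z => clip C (gradient (fun θ' => ℓ θ' z) p.1)).sum +
          p.2 • clip C (gradient (fun θ' => ℓ θ' z) p.1))).sum

lemma norm_clip_le {C : ℝ} (hC : 0 < C) (v : EuclideanSpace ℝ (Fin d)) : ‖clip C v‖ ≤ C := by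
  have h : 0 < max 1 (‖v‖ / C) := lt_max_of_lt_left one_pos
  rw [clip, norm_smul, norm_inv, Real.norm_of_nonneg h.le, inv_mul_le_iff₀ h]
  exact (div_le_iff₀ hC).1 (le_max_right _ _)

variable {ℓ : EuclideanSpace ℝ (Fin d) → Z → ℝ}

lemma measurable_sum_clip_gradient
    (hg : ∀ z, Measurable fun θ : EuclideanSpace ℝ (Fin d) => gradient (fun θ' => ℓ θ' z) θ)
    (C : ℝ) (B : Multiset Z) :
    Measurable fun θ : EuclideanSpace ℝ (Fin d) =>
      (B.map fun z => clip C (gradient (fun θ' => ℓ θ' z) θ)).sum := by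
  induction B using Multiset.induction_on with
  | empty => simp
  | cons a B ih =>
    simp only [Multiset.map_cons, Multiset.sum_cons]
    exact ((measurable_clip C).comp (hg a)).add ih

lemma measurable_shearNoise_comp (s c : ℝ)
    {u v : EuclideanSpace ℝ (Fin d) → EuclideanSpace ℝ (Fin d)} (hv : Measurable v)
    (hu : Measurable u) :
    Measurable fun p : EuclideanSpace ℝ (Fin d) × ℝ =>
      shearNoise s (c • v p.1) (u p.1 + p.2 • v p.1) := by
  have h : Measurable fun p : EuclideanSpace ℝ (Fin d) × ℝ =>
      (c • v p.1, u p.1 + p.2 • v p.1) := by fun_prop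
  exact (measurable_shearNoise s).comp h

lemma measurable_shearNoise_line (s : ℝ) (w m v : EuclideanSpace ℝ (Fin d)) :
    Measurable fun x : ℝ => shearNoise s w (m + x • v) := by
  have h : Measurable fun x : ℝ => (w, m + x • v) := by fun_prop
  exact (measurable_shearNoise s).comp h

lemma measurable_shearNoise_sum
    (hg : ∀ z, Measurable fun θ : EuclideanSpace ℝ (Fin d) => gradient (fun θ' => ℓ θ' z) θ)
    (C σ : ℝ) (z : Z) (B : Multiset Z) :
    Measurable fun p : EuclideanSpace ℝ (Fin d) × ℝ =>
      shearNoise (C * σ) (C⁻¹ • clip C (gradient (fun θ' => ℓ θ' z) p.1))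
        ((B.map fun z => clip C (gradient (fun θ' => ℓ θ' z) p.1)).sum +
          p.2 • clip C (gradient (fun θ' => ℓ θ' z) p.1)) := by
  exact measurable_shearNoise_comp _ _ ((measurable_clip C).comp (hg z))
    (measurable_sum_clip_gradient hg C B)

lemma measurable_scoredGrad
    (hg : ∀ z, Measurable fun θ : EuclideanSpace ℝ (Fin d) => gradient (fun θ' => ℓ θ' z) θ)
    (C σ q : ℝ) (D : Multiset Z) (z : Z) :
    Measurable (scoredGrad ℓ C σ q D z) :=
  measurable_multisetSum_smul _ _ fun B => measurable_shearNoise_sum hg C σ z B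

lemma isProbabilityMeasure_scoredGrad (C σ : ℝ) {q : ℝ} (hq : q ∈ Set.Icc (0 : ℝ) 1)
    (D : Multiset Z) (z : Z) (p : EuclideanSpace ℝ (Fin d) × ℝ) :
    IsProbabilityMeasure (scoredGrad ℓ C σ q D z p) := by
  have h := (isProbabilityMeasure_privGrad ℓ C σ q hq D p.1).measure_univ
  rw [privGrad, multisetSum_smul_apply] at h
  refine ⟨?_⟩
  rw [scoredGrad, multisetSum_smul_apply]
  simpa only [measure_univ] using h

/-- Averaging over the score commutes with the mixture over batches of `D`. The mean `b` is 0 when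
the target point is left out of the batch and 1 when it is included. -/
lemma bind_scoredGrad {C : ℝ} (hC : 0 < C) (σ q : ℝ) (D : Multiset Z) (z : Z)
    (θ : EuclideanSpace ℝ (Fin d)) (b : ℝ) :
    (gaussianReal b (.mk (σ ^ 2) (sq_nonneg σ))).bind
        (fun x => scoredGrad ℓ C σ q D z (θ, x)) =
      (D.powerset.map fun B =>
        ENNReal.ofReal (q ^ B.card * (1 - q) ^ (D.card - B.card)) •
          isoGaussian ((B.map fun z => clip C (gradient (fun θ' => ℓ θ' z) θ)).sum +
            b • clip C (gradient (fun θ' => ℓ θ' z) θ)) (C * σ)).sum := by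
  simp only [scoredGrad]
  rw [bind_multisetSum_smul _ _ _ fun B => measurable_shearNoise_line _ _ _ _]
  simp_rw [bind_shearNoise hC _ (norm_clip_le hC _)]

/-- Without the target point, its score has law `N(0, σ²)`. -/
lemma scoreOut_bind_scoredGrad {C : ℝ} (hC : 0 < C) (σ q : ℝ) (D : Multiset Z) (z : Z)
    (θ : EuclideanSpace ℝ (Fin d)) :
    (scoreOut σ).bind (fun x => scoredGrad ℓ C σ q D z (θ, x)) = privGrad ℓ C σ q D θ := by
  rw [scoreOut, bind_scoredGrad hC, privGrad]
  simp

/-- With the target point, its score has law `(1 - q) N(0, σ²) + q N(1, σ²)`. -/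
lemma scoreIn_bind_scoredGrad
    (hg : ∀ z, Measurable fun θ : EuclideanSpace ℝ (Fin d) => gradient (fun θ' => ℓ θ' z) θ)
    {C : ℝ} (hC : 0 < C) (σ : ℝ) {q : ℝ} (hq : q ∈ Set.Icc (0 : ℝ) 1)
    (D : Multiset Z) (z : Z) (θ : EuclideanSpace ℝ (Fin d)) :
    (scoreIn σ q).bind (fun x => scoredGrad ℓ C σ q D z (θ, x)) =
      privGrad ℓ C σ q (z ::ₘ D) θ := by
  have hq1 : 0 ≤ 1 - q := by linarith [hq.2]
  have hm : Measurable fun x => scoredGrad ℓ C σ q D z (θ, x) :=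
    (measurable_scoredGrad hg C σ q D z).comp measurable_prodMk_left
  rw [scoreIn, smul_add_smul_bind _ _ _ _ hm,
    scoreOut_bind_scoredGrad hC, bind_scoredGrad hC]
  simp only [privGrad, Multiset.powerset_cons, Multiset.map_add, Multiset.sum_add,
    Multiset.map_map, Function.comp_def, Multiset.map_cons, Multiset.sum_cons, Multiset.card_cons,
    Multiset.smul_sum, smul_smul, one_smul]
  -- The batches of `z ::ₘ D` are those of `D` without and with `z`; the mixture weights `1 - q` and
  -- `q` of the score supply the extra factor.
  congr 2
  · refine Multiset.map_congr rfl fun B hB => ?_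
    -- `B ≤ D` is needed for the truncated subtraction to gain exactly one factor `1 - q`.
    have := Multiset.card_le_card (Multiset.mem_powerset.1 hB)
    rw [← ENNReal.ofReal_mul hq1, Nat.succ_sub this, pow_succ]
    ring_nf
  · refine Multiset.map_congr rfl fun B hB => ?_
    rw [← ENNReal.ofReal_mul hq.1, Nat.add_sub_add_right, pow_succ, add_comm (clip _ _)]
    ring_nf

end Score

/-! ### The transcript as a randomized function of the scores -/

section Transcript

variable {d : ℕ}

lemma measurable_fin_cons {α : Type*} [MeasurableSpace α] (T : ℕ) :
    Measurable fun p : α × (Fin T → α) => (Fin.cons p.1 p.2 : Fin (T + 1) → α) := by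
  refine measurable_pi_iff.2 fun i => Fin.cases ?_ (fun j => ?_) i
  · simpa using measurable_fst
  · simp only [Fin.cons_succ]
    exact (measurable_pi_apply j).comp measurable_snd

lemma measurable_fin_tail {α : Type*} [MeasurableSpace α] (T : ℕ) :
    Measurable fun x : Fin (T + 1) → α => (Fin.tail x : Fin T → α) :=
  measurable_pi_iff.2 fun j => measurable_pi_apply j.succ

lemma lintegral_pi_fin_succ {α : Type*} [MeasurableSpace α] (γ : Measure α) [SigmaFinite γ]
    (T : ℕ) {f : (Fin (T + 1) → α) → ℝ≥0∞} (hf : Measurable f) :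
    ∫⁻ x, f x ∂(Measure.pi fun _ => γ) =
      ∫⁻ a, ∫⁻ y, f (Fin.cons a y) ∂(Measure.pi fun _ : Fin T => γ) ∂γ := by
  have h := (measurePreserving_piFinSuccAbove (fun _ : Fin (T + 1) => γ) 0).symm
  have hm : Measurable fun p => f ((MeasurableEquiv.piFinSuccAbove (fun _ => α) 0).symm p) :=
    hf.comp h.measurable
  rw [← h.lintegral_comp hf, lintegral_prod _ hm.aemeasurable]
  simp [MeasurableEquiv.piFinSuccAbove, Fin.insertNthEquiv]

/-- The transcript of noisy gradient descent when the step at the parameters `θ` with score `x`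
draws from `κ (θ, x)`, as a kernel from initial parameters and scores. -/
def scoredTranscript (κ : Kernel (EuclideanSpace ℝ (Fin d) × ℝ) (EuclideanSpace ℝ (Fin d))) :
    (T : ℕ) → (lr : ℕ → ℝ) →
      Kernel (EuclideanSpace ℝ (Fin d) × (Fin T → ℝ)) (Fin T → EuclideanSpace ℝ (Fin d))
  | 0, _ => Kernel.const _ (Measure.dirac Fin.elim0)
  | T + 1, lr =>
      ((κ.comap (fun p : EuclideanSpace ℝ (Fin d) × (Fin (T + 1) → ℝ) => (p.1, p.2 0))
          (by fun_prop)) ⊗ₖ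
        ((scoredTranscript κ T fun t => lr (t + 1)).comap
          (fun p : (EuclideanSpace ℝ (Fin d) × (Fin (T + 1) → ℝ)) × EuclideanSpace ℝ (Fin d) =>
            (p.1.1 - lr 0 • p.2, (Fin.tail p.1.2 : Fin T → ℝ)))
          (Measurable.prodMk (by fun_prop)
            ((measurable_fin_tail T).comp (measurable_snd.comp measurable_fst))))).map
        fun p => (Fin.cons p.1 p.2 : Fin (T + 1) → EuclideanSpace ℝ (Fin d))

instance isMarkovKernel_scoredTranscript
    (κ : Kernel (EuclideanSpace ℝ (Fin d) × ℝ) (EuclideanSpace ℝ (Fin d))) [IsMarkovKernel κ]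
    (T : ℕ) (lr : ℕ → ℝ) : IsMarkovKernel (scoredTranscript κ T lr) := by
  induction T generalizing lr with
  | zero => unfold scoredTranscript; infer_instance
  | succ T ih =>
    have := ih fun t => lr (t + 1)
    unfold scoredTranscript
    exact Kernel.IsMarkovKernel.map _ (measurable_fin_cons T)

/-- If each privatized gradient is obtained from a score of law `γ`, the transcript is obtained
from independent scores of law `γ`. -/
lemma dpsgd_eq_bind_scoredTranscript {Z : Type*} {ℓ : EuclideanSpace ℝ (Fin d) → Z → ℝ}
    {C σ q : ℝ} {D : Multiset Z}
    (κ : Kernel (EuclideanSpace ℝ (Fin d) × ℝ) (EuclideanSpace ℝ (Fin d))) [IsMarkovKernel κ]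
    (γ : Measure ℝ) [IsProbabilityMeasure γ]
    (hκ : ∀ θ, γ.bind (fun x => κ (θ, x)) = privGrad ℓ C σ q D θ)
    (T : ℕ) (lr : ℕ → ℝ) (θ : EuclideanSpace ℝ (Fin d)) :
    dpsgd ℓ C σ q D T lr θ =
      (Measure.pi fun _ : Fin T => γ).bind fun x => scoredTranscript κ T lr (θ, x) := by
  induction T generalizing lr θ with
  | zero => simp [dpsgd, scoredTranscript]
  | succ T ih =>
    have hcons := measurable_fin_cons (α := EuclideanSpace ℝ (Fin d)) T
    set K := scoredTranscript κ T fun t => lr (t + 1)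
    ext A hA
    let κ' : Kernel (EuclideanSpace ℝ (Fin d) × (Fin T → ℝ)) (Fin T → EuclideanSpace ℝ (Fin d)) :=
      K.comap (fun p => (θ - lr 0 • p.1, p.2)) (by fun_prop)
    have hKm : ∀ θ, Measurable fun y => K (θ, y) := fun θ =>
      K.measurable.comp measurable_prodMk_left
    have hH : ∀ A : Set (Fin (T + 1) → EuclideanSpace ℝ (Fin d)), MeasurableSet A →
        Measurable fun p : EuclideanSpace ℝ (Fin d) × (Fin T → ℝ) =>
          K (θ - lr 0 • p.1, p.2) ((fun gs => Fin.cons p.1 gs) ⁻¹' A) := by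
      intro A hA
      have hm : Measurable fun p : (EuclideanSpace ℝ (Fin d) × (Fin T → ℝ)) ×
          (Fin T → EuclideanSpace ℝ (Fin d)) =>
            (Fin.cons p.1.1 p.2 : Fin (T + 1) → EuclideanSpace ℝ (Fin d)) :=
        hcons.comp (Measurable.prodMk (by fun_prop) measurable_snd)
      exact Kernel.measurable_kernel_prodMk_left (κ := κ') (hm hA)
    have hmap : ∀ (A : Set (Fin (T + 1) → EuclideanSpace ℝ (Fin d))), MeasurableSet A → ∀ g,
        (dpsgd ℓ C σ q D T (fun t => lr (t + 1)) (θ - lr 0 • g)).map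
          (fun gs : Fin T → EuclideanSpace ℝ (Fin d) =>
            (Fin.cons g gs : Fin (T + 1) → EuclideanSpace ℝ (Fin d))) A =
        ∫⁻ y, K (θ - lr 0 • g, y) ((fun gs => Fin.cons g gs) ⁻¹' A)
          ∂(Measure.pi fun _ : Fin T => γ) := by
      intro A hA g
      have hc : Measurable fun gs : Fin T → EuclideanSpace ℝ (Fin d) =>
        (Fin.cons g gs : Fin (T + 1) → EuclideanSpace ℝ (Fin d)) :=
          hcons.comp measurable_prodMk_left
      rw [Measure.map_apply hc hA, ih, Measure.bind_apply (hc hA) (hKm _).aemeasurable]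
    -- Measurability in `g` of the remaining run is read off from its representation by scores,
    -- given by the induction hypothesis.
    have hm1 : Measurable fun g => (dpsgd ℓ C σ q D T (fun t => lr (t + 1)) (θ - lr 0 • g)).map
        (fun gs : Fin T → EuclideanSpace ℝ (Fin d) =>
          (Fin.cons g gs : Fin (T + 1) → EuclideanSpace ℝ (Fin d))) := by
      refine Measure.measurable_of_measurable_coe _ fun A hA => ?_
      simp_rw [hmap A hA]
      exact (hH A hA).lintegral_prod_right'
    have hm2 : Measurable fun x => κ (θ, x) := κ.measurable.comp measurable_prodMk_left
    have hm3 : Measurable fun x => scoredTranscript κ (T + 1) lr (θ, x) :=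
      (scoredTranscript κ (T + 1) lr).measurable.comp measurable_prodMk_left
    have hm4 := (Measure.measurable_coe hA).comp hm1
    have hm5 := (Measure.measurable_coe hA).comp hm3
    simp only [Function.comp_def] at hm4 hm5
    rw [dpsgd, ← hκ, Measure.bind_apply hA hm1.aemeasurable,
      Measure.lintegral_bind hm2.aemeasurable hm4.aemeasurable,
      Measure.bind_apply hA hm3.aemeasurable, lintegral_pi_fin_succ _ _ hm5]
    refine lintegral_congr fun x => ?_
    simp_rw [hmap A hA]
    -- The recursion draws `g` before the later scores, `scoredTranscript` takes all scores as
    -- input; given the first score, the two draws are independent and may be exchanged.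
    rw [lintegral_lintegral_swap (hH A hA).aemeasurable]
    refine lintegral_congr fun y => ?_
    rw [scoredTranscript, Kernel.map_apply' _ hcons _ hA, Kernel.compProd_apply (hcons hA)]
    simp only [Kernel.comap_apply, Fin.cons_zero, Fin.tail_cons]
    rfl

end Transcript

/-! ### The dominating pair as the laws of independent scores -/

section DominatingPair

lemma isoGaussian_eq_map_pi {n : ℕ} (m : EuclideanSpace ℝ (Fin n)) (s : ℝ) :
    isoGaussian m s = (Measure.pi fun t => gaussianReal (m t) (.mk (s ^ 2) (sq_nonneg s))).map
      (WithLp.toLp 2) := by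
  have h : (fun t => gaussianReal (m t) (.mk (s ^ 2) (sq_nonneg s))) =
      fun t => (gaussianReal 0 1).map fun x => m t + s * x := by
    funext t
    have : (fun x : ℝ => m t + s * x) = (m t + ·) ∘ (s * ·) := rfl
    rw [this, ← Measure.map_map (by fun_prop) (by fun_prop), gaussianReal_map_const_mul,
      gaussianReal_map_const_add]
    simp
  have : ∀ t, IsProbabilityMeasure ((gaussianReal 0 1).map fun x => m t + s * x) := fun t =>
    Measure.isProbabilityMeasure_map (by fun_prop)
  rw [h, ← Measure.pi_map_pi (μ := fun _ : Fin n => gaussianReal 0 1)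
    (f := fun t x => m t + s * x) (fun t => by fun_prop), isoGaussian, ← map_pi_eq_stdGaussian,
    Measure.map_map (by fun_prop) (by fun_prop), Measure.map_map (by fun_prop) (by fun_prop)]
  rfl

/-- On a box this is the distributive law for a product of sums; `w` records the component chosen in
each coordinate. -/
lemma pi_sum_smul {ι β α : Type*} [Fintype ι] [DecidableEq ι] [Fintype β] [MeasurableSpace α]
    (c : β → ℝ≥0∞) (γ : β → Measure α) [∀ b, SigmaFinite (γ b)] [SigmaFinite (∑ b, c b • γ b)] :
    Measure.pi (fun _ : ι => ∑ b, c b • γ b) =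
      ∑ w : ι → β, (∏ i, c (w i)) • Measure.pi fun i => γ (w i) := by
  refine Measure.pi_eq fun s hs => ?_
  simp only [Measure.coe_finsetSum, Finset.sum_apply, Measure.smul_apply, smul_eq_mul,
    Measure.pi_pi, ← Finset.prod_mul_distrib]
  rw [Finset.prod_univ_sum, Fintype.piFinset_univ]

lemma pi_absolutelyContinuous {α : Type*} [MeasurableSpace α] {μ ν : Measure α} [SigmaFinite μ]
    [SigmaFinite ν] (h : μ ≪ ν) (T : ℕ) :
    Measure.pi (fun _ : Fin T => μ) ≪ Measure.pi fun _ : Fin T => ν := by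
  induction T with
  | zero => rw [Measure.pi_of_empty, Measure.pi_of_empty]
  | succ T ih =>
    have hμ := (measurePreserving_piFinSuccAbove (fun _ : Fin (T + 1) => μ) 0).symm
    have hν := (measurePreserving_piFinSuccAbove (fun _ : Fin (T + 1) => ν) 0).symm
    rw [← hμ.map_eq, ← hν.map_eq]
    exact (h.prod ih).map hμ.measurable

lemma nuDom_eq_map_pi (T : ℕ) (σ : ℝ) :
    nuDom T σ = (Measure.pi fun _ => scoreOut σ).map (WithLp.toLp 2) := by
  rw [nuDom, isoGaussian_eq_map_pi]
  rfl

lemma muDom_eq_map_pi (T : ℕ) (σ : ℝ) {q : ℝ} (hq : q ∈ Set.Icc (0 : ℝ) 1) :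
    muDom T σ q = (Measure.pi fun _ => scoreIn σ q).map (WithLp.toLp 2) := by
  have hq1 : 0 ≤ 1 - q := by linarith [hq.2]
  have hin : scoreIn σ q = ∑ b : Bool, ENNReal.ofReal (if b then q else 1 - q) •
      gaussianReal (if b then 1 else 0) (.mk (σ ^ 2) (sq_nonneg σ)) := by
    simp [scoreIn, scoreOut, add_comm]
  have := isProbabilityMeasure_scoreIn σ hq
  rw [hin] at this
  rw [hin, pi_sum_smul, muDom]
  ext A hA
  have hm : Measurable (WithLp.toLp 2 : (Fin T → ℝ) → EuclideanSpace ℝ (Fin T)) := by fun_prop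
  rw [Measure.map_apply hm hA]
  simp only [Measure.coe_finsetSum, Finset.sum_apply, Measure.smul_apply, smul_eq_mul]
  refine Finset.sum_congr rfl fun w _ => ?_
  rw [ENNReal.ofReal_prod_of_nonneg fun t _ => by split_ifs; exacts [hq.1, hq1],
    isoGaussian_eq_map_pi, Measure.map_apply hm hA]

lemma scoreIn_absolutelyContinuous {σ : ℝ} (hσ : 0 < σ) (q : ℝ) : scoreIn σ q ≪ scoreOut σ := by
  have hv : NNReal.mk (σ ^ 2) (sq_nonneg σ) ≠ 0 := by
    rw [← NNReal.coe_ne_zero]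
    simpa using hσ.ne'
  refine Measure.AbsolutelyContinuous.add_left (Measure.smul_absolutelyContinuous)
    (Measure.smul_absolutelyContinuous.trans ?_)
  exact (gaussianReal_absolutelyContinuous _ hv).trans (gaussianReal_absolutelyContinuous' _ hv)

lemma muDom_absolutelyContinuous (T : ℕ) {σ : ℝ} (hσ : 0 < σ) {q : ℝ}
    (hq : q ∈ Set.Icc (0 : ℝ) 1) : muDom T σ q ≪ nuDom T σ := by
  have := isProbabilityMeasure_scoreIn σ hq
  rw [muDom_eq_map_pi T σ hq, nuDom_eq_map_pi]
  exact (pi_absolutelyContinuous (scoreIn_absolutelyContinuous hσ q) T).map (by fun_prop)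

lemma isProbabilityMeasure_muDom (T : ℕ) (σ : ℝ) {q : ℝ} (hq : q ∈ Set.Icc (0 : ℝ) 1) :
    IsProbabilityMeasure (muDom T σ q) := by
  have := isProbabilityMeasure_scoreIn σ hq
  rw [muDom_eq_map_pi T σ hq]
  exact Measure.isProbabilityMeasure_map (by fun_prop)

instance isProbabilityMeasure_nuDom (T : ℕ) (σ : ℝ) : IsProbabilityMeasure (nuDom T σ) := by
  unfold nuDom; infer_instance

/-- Each coordinate is a nondegenerate Gaussian, hence atomless. This lets a coordinate break ties
of the likelihood ratio, which can be constant (for `q = 0`, say). -/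
lemma nuDom_hyperplane {T : ℕ} {σ : ℝ} (hσ : 0 < σ) (i : Fin T) (a : ℝ) :
    nuDom T σ {x | x i = a} = 0 := by
  have hv : NNReal.mk (σ ^ 2) (sq_nonneg σ) ≠ 0 := by
    rw [← NNReal.coe_ne_zero]
    simpa using hσ.ne'
  have : NullSingletonClass (scoreOut σ) := nullSingletonClass_gaussianReal hv
  have hs : MeasurableSet {x : EuclideanSpace ℝ (Fin T) | x i = a} :=
    measurableSet_eq_fun (by fun_prop) (by fun_prop)
  rw [nuDom_eq_map_pi, Measure.map_apply (by fun_prop) hs]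
  exact Measure.pi_hyperplane (fun _ : Fin T => scoreOut σ) i a

end DominatingPair

/-! ### Reconstruction robustness -/

/-- For a fixed target point, the laws of the transcript with and without it are the images of the
dominating pair under one Markov kernel. -/
lemma exists_kernel_dpsgd {Z : Type*} {d : ℕ} {ℓ : EuclideanSpace ℝ (Fin d) → Z → ℝ}
    (hg : ∀ z, Measurable fun θ : EuclideanSpace ℝ (Fin d) => gradient (fun θ' => ℓ θ' z) θ)
    {C : ℝ} (hC : 0 < C) (σ : ℝ) {q : ℝ} (hq : q ∈ Set.Icc (0 : ℝ) 1) (D : Multiset Z) (z : Z)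
    (T : ℕ) (lr : ℕ → ℝ) (θ : EuclideanSpace ℝ (Fin d)) :
    ∃ K : Kernel (EuclideanSpace ℝ (Fin T)) (Fin T → EuclideanSpace ℝ (Fin d)), IsMarkovKernel K ∧
      dpsgd ℓ C σ q (z ::ₘ D) T lr θ = (muDom T σ q).bind K ∧
      dpsgd ℓ C σ q D T lr θ = (nuDom T σ).bind K := by
  have := isProbabilityMeasure_scoreIn σ hq
  let κ : Kernel (EuclideanSpace ℝ (Fin d) × ℝ) (EuclideanSpace ℝ (Fin d)) :=
    ⟨_, measurable_scoredGrad hg C σ q D z⟩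
  have : IsMarkovKernel κ := ⟨fun p => isProbabilityMeasure_scoredGrad C σ hq D z p⟩
  let K := (scoredTranscript κ T lr).comap
    (fun x : EuclideanSpace ℝ (Fin T) => (θ, WithLp.ofLp x)) (by fun_prop)
  have hbind : ∀ γ : Measure ℝ, (Measure.pi fun _ => γ).bind
      (fun x => scoredTranscript κ T lr (θ, x)) =
        ((Measure.pi fun _ => γ).map (WithLp.toLp 2)).bind K := fun γ => by
    have hK : Measurable fun x : Fin T → ℝ => scoredTranscript κ T lr (θ, x) :=
      (scoredTranscript κ T lr).measurable.comp measurable_prodMk_left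
    ext A hA
    rw [Measure.bind_apply hA hK.aemeasurable, Measure.bind_apply hA K.aemeasurable,
      lintegral_map (K.measurable_coe hA) (by fun_prop)]
    rfl
  refine ⟨K, inferInstance, ?_, ?_⟩
  · rw [muDom_eq_map_pi T σ hq, ← hbind]
    exact dpsgd_eq_bind_scoredTranscript κ (scoreIn σ q)
      (fun θ => scoreIn_bind_scoredGrad hg hC σ hq D z θ) T lr θ
  · rw [nuDom_eq_map_pi T σ, ← hbind]
    exact dpsgd_eq_bind_scoredTranscript κ (scoreOut σ)
      (fun θ => scoreOut_bind_scoredGrad hC σ q D z θ) T lr θ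

end

/-- The mechanism releasing all `T` intermediate gradients of DP-SGD is `(η, γ)`-reconstruction
robust with `γ = B_{κ_{π,ρ}(η)}(μ_{T,σ,q}, ν_{T,σ})`. -/
theorem mainTheorem2 {Z : Type*} [MeasurableSpace Z] {d : ℕ}
    (ℓ : EuclideanSpace ℝ (Fin d) → Z → ℝ)
    (hℓ : Measurable fun p : EuclideanSpace ℝ (Fin d) × Z =>
      gradient (fun θ' => ℓ θ' p.2) p.1)
    (θ₀ : EuclideanSpace ℝ (Fin d)) (lr : ℕ → ℝ)
    (C : ℝ) (hC : 0 < C) (σ : ℝ) (hσ : 0 < σ) (q : ℝ) (hq : q ∈ Set.Icc (0 : ℝ) 1)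
    (T : ℕ) (hT : 1 ≤ T)
    (π : Measure Z) [IsProbabilityMeasure π]
    (ρ : Z → Z → ℝ) (hρ : Measurable (Function.uncurry ρ)) (η : ℝ) :
    IsReRo (fun D => dpsgd ℓ C σ q D T lr θ₀) π ρ η
      (blowUp (priorSuccess π ρ η) (muDom T σ q) (nuDom T σ)) := by
  intro D R hR
  have hg : ∀ z, Measurable fun θ : EuclideanSpace ℝ (Fin d) =>
      gradient (fun θ' => ℓ θ' z) θ := fun z => hℓ.comp (measurable_id.prodMk measurable_const)
  have hE2 : MeasurableSet {p : Z × (Fin T → EuclideanSpace ℝ (Fin d)) | ρ p.1 (R p.2) ≤ η} :=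
    measurableSet_le (hρ.comp (measurable_fst.prodMk (hR.comp measurable_snd))) measurable_const
  have hE : ∀ z, MeasurableSet {w | ρ z (R w) ≤ η} := fun z => measurable_prodMk_left hE2
  have := isProbabilityMeasure_muDom T σ hq
  obtain ⟨z₀⟩ : Nonempty Z := π.nonempty_of_neZero
  -- `K z` need not be measurable in `z`: only the laws of the transcripts are integrated over the
  -- prior.
  choose K hK hKin hKout using fun z => exists_kernel_dpsgd hg hC σ hq D z T lr θ₀
  have hM : IsProbabilityMeasure (dpsgd ℓ C σ q D T lr θ₀) := by
    rw [hKout z₀]; infer_instance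
  have hKm : ∀ z, Measurable fun x => K z x {w | ρ z (R w) ≤ η} := fun z =>
    (K z).measurable_coe (hE z)
  have e1 : ∀ z, dpsgd ℓ C σ q (z ::ₘ D) T lr θ₀ {w | ρ z (R w) ≤ η} =
      ∫⁻ x, K z x {w | ρ z (R w) ≤ η} ∂(muDom T σ q) := fun z => by
    rw [hKin z, Measure.bind_apply (hE z) (K z).aemeasurable]
  have e2 : ∀ z, dpsgd ℓ C σ q D T lr θ₀ {w | ρ z (R w) ≤ η} =
      ∫⁻ x, K z x {w | ρ z (R w) ≤ η} ∂(nuDom T σ) := fun z => by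
    rw [hKout z, Measure.bind_apply (hE z) (K z).aemeasurable]
  set κ := priorSuccess π ρ η
  -- Without the target point the transcript is independent of `Z`; by Fubini, each fixed guess `R
  -- w` succeeds with probability at most `κ`.
  have hprior : ∫⁻ z, dpsgd ℓ C σ q D T lr θ₀ {w | ρ z (R w) ≤ η} ∂π ≤ κ := by
    have e := Measure.prod_apply (μ := π) (ν := dpsgd ℓ C σ q D T lr θ₀) hE2
    have e' := Measure.prod_apply_symm (μ := π) (ν := dpsgd ℓ C σ q D T lr θ₀) hE2
    calc _ = ∫⁻ w, π {z | ρ z (R w) ≤ η} ∂(dpsgd ℓ C σ q D T lr θ₀) := e.symm.trans e'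
      _ ≤ ∫⁻ _, κ ∂(dpsgd ℓ C σ q D T lr θ₀) :=
          lintegral_mono fun w => le_iSup (fun z₀ => π {z | ρ z z₀ ≤ η}) (R w)
      _ = κ := by simp
  have hκ1 : κ ≤ 1 := iSup_le fun _ => prob_le_one
  have hDm : Measurable fun z => dpsgd ℓ C σ q D T lr θ₀ {w | ρ z (R w) ≤ η} :=
    measurable_measure_prodMk_left hE2
  -- At `κ = 0` a finite slope may fail to exist; there almost every test has size 0, hence power 0
  -- by absolute continuity.
  rcases eq_or_ne κ 0 with h0 | h0
  · have hae : ∀ᵐ z ∂π, dpsgd ℓ C σ q D T lr θ₀ {w | ρ z (R w) ≤ η} = 0 := by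
      rw [h0, nonpos_iff_eq_zero, lintegral_eq_zero_iff hDm] at hprior
      exact hprior
    have hae' : ∀ᵐ z ∂π, dpsgd ℓ C σ q (z ::ₘ D) T lr θ₀ {w | ρ z (R w) ≤ η} = 0 := by
      filter_upwards [hae] with z hz
      rw [e2, lintegral_eq_zero_iff (hKm z)] at hz
      rw [e1, lintegral_eq_zero_iff (hKm z)]
      exact (muDom_absolutelyContinuous T hσ hq).ae_le hz
    rw [lintegral_congr_ae hae', lintegral_zero]
    exact bot_le
  · have hh : Measurable fun x : EuclideanSpace ℝ (Fin T) =>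
        ENNReal.ofReal (Real.exp (x ⟨0, hT⟩)) := by fun_prop
    have hnull : ∀ s, nuDom T σ {x | ENNReal.ofReal (Real.exp (x ⟨0, hT⟩)) = s} = 0 := fun s => by
      refine measure_mono_null (fun x hx => ?_)
        (nuDom_hyperplane hσ ⟨0, hT⟩ (Real.log s.toReal))
      change ENNReal.ofReal _ = s at hx
      change x ⟨0, hT⟩ = Real.log s.toReal
      rw [← hx, ENNReal.toReal_ofReal (Real.exp_pos _).le, Real.log_exp]
    obtain ⟨c, hc, hc'⟩ := exists_blowUp_multiplier (muDom T σ q) (nuDom T σ)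
      (muDom_absolutelyContinuous T hσ hq) hh hnull h0 hκ1
    have hpt : ∀ z, dpsgd ℓ C σ q (z ::ₘ D) T lr θ₀ {w | ρ z (R w) ≤ η} + c * κ ≤
        blowUp κ (muDom T σ q) (nuDom T σ) +
          c * dpsgd ℓ C σ q D T lr θ₀ {w | ρ z (R w) ≤ η} := fun z => by
      rw [e1, e2]
      exact hc' _ (hKm z) fun x => prob_le_one
    have hcκ : c * κ ≠ ∞ := ENNReal.mul_ne_top hc (hκ1.trans_lt ENNReal.one_lt_top).ne
    -- The term `c * κ` is kept on the left to avoid subtraction in `ℝ≥0∞`; being finite, it cancels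
    -- against the averaged size bound `hprior`.
    refine (ENNReal.add_le_add_iff_right hcκ).1 ?_
    calc _ = ∫⁻ z, dpsgd ℓ C σ q (z ::ₘ D) T lr θ₀ {w | ρ z (R w) ≤ η} + c * κ ∂π := by
          rw [lintegral_add_right _ measurable_const]; simp
      _ ≤ ∫⁻ z, blowUp κ (muDom T σ q) (nuDom T σ) +
          c * dpsgd ℓ C σ q D T lr θ₀ {w | ρ z (R w) ≤ η} ∂π := lintegral_mono hpt
      _ = blowUp κ (muDom T σ q) (nuDom T σ) +
          c * ∫⁻ z, dpsgd ℓ C σ q D T lr θ₀ {w | ρ z (R w) ≤ η} ∂π := by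
          rw [lintegral_add_left measurable_const, lintegral_const_mul _ hDm]; simp
      _ ≤ _ := by gcongr
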